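/- Let $\{|p\rangle,|q\rangle,|1\rangle,|2\rangle\}$ be an orthonormal basis of $\mathbb{C}^4_A$, and let $\{|p\rangle,|q\rangle,|1\rangle\}$ and $\{|p\rangle,|q\rangle,|2\rangle\}$ be orthonormal bases of $\mathbb{C}^3_B$ and $\mathbb{C}^3_C$, respectively. Put $|\epsilon_\pm\rangle=\frac{1}{\sqrt2}(|p\rangle\pm|q\rangle)$ and $|\gamma^i_\pm\rangle=\frac{1}{\sqrt2}(|q\rangle\pm|i\rangle)$ for $i\in\{1,2\}$, and let $\mathbb{G}_3\subset\mathbb{C}^4_A\otimes\mathbb{C}^3_B\otimes\mathbb{C}^3_C$ be the set of the fourteen states $$|\epsilon_\pm\rangle_A|1\rangle_B|2\rangle_C,\quad |1\rangle_A|\gamma^1_\pm\rangle_B|2\rangle_C,\quad |\gamma^1_\pm\rangle_A|p\rangle_B|2\rangle_C,\quad |p\rangle_A|\epsilon_\pm\rangle_B|2\rangle_C,$$ $$|2\rangle_A|1\rangle_B|\gamma^2_\pm\rangle_C,\quad |\gamma^2_\pm\rangle_A|1\rangle_B|p\rangle_C,\quad |p\rangle_A|1\rangle_B|\epsilon_\pm\rangle_C.$$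 Then $\mathbb{G}_3$ is a genuinely nonlocal set of product states (GNPS): its elements are pairwise orthogonal, normalized, fully product states, and for each bipartition of the three parties ($A|BC$, $B|AC$, $C|AB$) the states of $\mathbb{G}_3$, regarded as bipartite states shared by the two groups, cannot be perfectly discriminated by local operations and classical communication (LOCC). Here an LOCC protocol consists of a finite or infinite sequence of rounds; in each round one of the two groups performs a measurement (given by finitely or countably many Kraus operators, with arbitrary finite-dimensional output spaces) on its own system and announces the outcome, upon which the other group may apply a local isometry, and all choices may depend on all earlier outcomes. Perfect discrimination means that, for every state of the set, the probability that the state is correctly identified from the outcomes of the first $t$ rounds tends to $1$ as $t\to\infty$ (for a protocol with finitely many rounds: equals $1$ at the end). -/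

import Mathlib

open scoped ENNReal Topology Matrix

noncomputable section

namespace GNPS

/-! ### LOCC protocols for two parties

A pure state vector of the bipartite space `ℂ^α ⊗ ℂ^β` is written as its coefficient matrix
`ψ : Matrix α β ℂ`; the operator `A ⊗ B` then acts as `ψ ↦ A * ψ * Bᵀ`. -/

/-- A two-party LOCC protocol on `ℂ^α ⊗ ℂ^β`, with an unbounded number of rounds.
The public record of outcomes is a list of natural numbers, most recent outcome first. After the
record `h` the two laboratories hold systems of dimensions `dimA h` and `dimB h`. In each step one
of the two parties performs a measurement with (finitely or countably many) Kraus operators and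
announces the outcome; the other party, knowing the outcome, may apply a local isometry. Who
measures, and which operators are used, may depend on the whole record `h`.

A measurement with finitely many outcomes has zero Kraus operators for the other labels. A quantum
instrument whose outcomes have several Kraus operators each, or a local channel, is the special
case in which the later choices ignore a part of the record; local ancillas are covered since
dimensions may change, and shared randomness since Kraus operators may be multiples of the
identity. A protocol with finitely many rounds continues with trivial measurements. -/
structure Protocol (α β : Type) [Fintype α] [Fintype β] [DecidableEq α] [DecidableEq β] where
  dimA : List ℕ → ℕ
  dimB : List ℕ → ℕ
  /-- the isometric embeddings of the given systems into the laboratories -/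
  initA : Matrix (Fin (dimA [])) α ℂ
  initB : Matrix (Fin (dimB [])) β ℂ
  initA_isometry : initAᴴ * initA = 1
  initB_isometry : initBᴴ * initB = 1
  krausA : ∀ (h : List ℕ) (x : ℕ), Matrix (Fin (dimA (x :: h))) (Fin (dimA h)) ℂ
  krausB : ∀ (h : List ℕ) (x : ℕ), Matrix (Fin (dimB (x :: h))) (Fin (dimB h)) ℂ
  /-- either the first party measures and the second one applies isometries, or vice versa -/
  step : ∀ h : List ℕ,
    (HasSum (fun x => (krausA h x)ᴴ * krausA h x) 1 ∧
      ∀ x, (krausB h x)ᴴ * krausB h x = 1) ∨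
    (HasSum (fun x => (krausB h x)ᴴ * krausB h x) 1 ∧
      ∀ x, (krausA h x)ᴴ * krausA h x = 1)

namespace Protocol

variable {α β : Type} [Fintype α] [Fintype β] [DecidableEq α] [DecidableEq β]

open Classical in
/-- The probability that, starting after the record `h` with the (subnormalized) state `ψ`, the
record after `t` further steps lies in `E`. -/
def probFrom (P : Protocol α β) (E : Set (List ℕ)) :
    ∀ (_ : ℕ) (h : List ℕ), Matrix (Fin (P.dimA h)) (Fin (P.dimB h)) ℂ → ℝ≥0∞
  | 0, h, ψ => if h ∈ E then ∑ i, ∑ j, ‖ψ i j‖ₑ ^ 2 else 0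
  | t + 1, h, ψ =>
      ∑' x : ℕ, P.probFrom E t (x :: h) (P.krausA h x * ψ * (P.krausB h x)ᵀ)

/-- The probability that the record after `t` steps lies in `E` when the protocol is run on `ψ`. -/
def prob (P : Protocol α β) (E : Set (List ℕ)) (t : ℕ) (ψ : Matrix α β ℂ) : ℝ≥0∞ :=
  P.probFrom E t [] (P.initA * ψ * P.initBᵀ)

end Protocol

/-- The family of bipartite states `ψ` can be perfectly discriminated by LOCC: there are an LOCC
protocol and a rule `guess`, which reads a guess off the public record (`none`: undecided), such
that, whichever state `ψ i` is given, the probability that the guess after `t` steps is `i` tends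
to `1` as `t → ∞`. For a protocol that ends after finitely many rounds this says that the final
guess is correct with probability `1`. -/
def PerfectlyDiscriminable {α β : Type} [Fintype α] [Fintype β] [DecidableEq α] [DecidableEq β]
    {κ : Type*} (ψ : κ → Matrix α β ℂ) : Prop :=
  ∃ (P : Protocol α β) (guess : List ℕ → Option κ), ∀ i : κ,
    Filter.Tendsto (fun t => P.prob {h | guess h = some i} t (ψ i)) Filter.atTop (𝓝 1)

/-! ### Multipartite states -/

/-- The space `⨂ⱼ ℂ^(d j)` of `n` parties, in coordinates. -/
abbrev Space {n : ℕ} (d : Fin n → ℕ) : Type := EuclideanSpace ℂ (∀ j, Fin (d j))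

/-- The product vector `⨂ⱼ φ j`. -/
def tensor {n : ℕ} {d : Fin n → ℕ} (φ : ∀ j, EuclideanSpace ℂ (Fin (d j))) : Space d :=
  WithLp.toLp 2 fun x => ∏ j, φ j (x j)

/-- The state `ψ` viewed as a bipartite state for the cut `S | Sᶜ` of the set of parties. -/
def cut {n : ℕ} {d : Fin n → ℕ} (S : Finset (Fin n)) (ψ : Space d) :
    Matrix (∀ j : {j // j ∈ S}, Fin (d j)) (∀ j : {j // j ∉ S}, Fin (d j)) ℂ :=
  fun u v => ψ ((Equiv.piEquivPiSubtypeProd (· ∈ S) fun j => Fin (d j)).symm (u, v))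

/-- A genuinely nonlocal set of product states: pairwise orthogonal, normalized, fully product
states that cannot be perfectly discriminated by LOCC across any bipartition of the parties. -/
structure IsGNPS {n : ℕ} {d : Fin n → ℕ} (G : Set (Space d)) : Prop where
  orthonormal : Orthonormal ℂ (Subtype.val : G → Space d)
  product : ∀ ψ ∈ G, ∃ φ : ∀ j, EuclideanSpace ℂ (Fin (d j)), ψ = tensor φ
  nonlocal : ∀ S : Finset (Fin n), S.Nonempty → Sᶜ.Nonempty →
    ¬ PerfectlyDiscriminable (fun ψ : G => cut S (ψ : Space d))

/-! ### The set `𝔾₃` -/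

/-- `|a⟩ ⊗ |b⟩ ⊗ |c⟩` in `ℂ⁴ ⊗ ℂ³ ⊗ ℂ³`. -/
def tri (a : EuclideanSpace ℂ (Fin 4)) (b c : EuclideanSpace ℂ (Fin 3)) : Space ![4, 3, 3] :=
  tensor fun j => match j with
    | 0 => a
    | 1 => b
    | 2 => c

/-- `(u + s v) / √2`, for a sign `s`. -/
def pm {m : ℕ} (s : ℂ) (u v : EuclideanSpace ℂ (Fin m)) : EuclideanSpace ℂ (Fin m) :=
  ((1 / √2 : ℝ) : ℂ) • (u + s • v)

/-- The fourteen states of `𝔾₃`; the kets `|p⟩, |q⟩, |1⟩, |2⟩` of the first party are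
`pA, qA, oneA, twoA`, and similarly for the second (`|p⟩, |q⟩, |1⟩`) and the third party
(`|p⟩, |q⟩, |2⟩`). -/
def G3 (pA qA oneA twoA : EuclideanSpace ℂ (Fin 4)) (pB qB oneB : EuclideanSpace ℂ (Fin 3))
    (pC qC twoC : EuclideanSpace ℂ (Fin 3)) : Set (Space ![4, 3, 3]) :=
  ⋃ s ∈ ({1, -1} : Set ℂ),
    {tri (pm s pA qA) oneB twoC,
      tri oneA (pm s qB oneB) twoC,
      tri (pm s qA oneA) pB twoC,
      tri pA (pm s pB qB) twoC,
      tri twoA oneB (pm s qC twoC),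
      tri (pm s qA twoA) oneB pC,
      tri pA oneB (pm s pC qC)}

end GNPS

end

/-!
In the course of a protocol the state `ψ i` becomes `(A ⊗ B) ψ i`, so that the record reached is
described by the effects `a = Aᴴ * A` and `b = Bᴴ * B`, and distinguishing `ψ i` from `ψ j` there is
possible only if `⟨ψ i| a ⊗ b |ψ j⟩` is small compared with the trace of `a ⊗ b`. For the domino
states, smallness of all these overlaps together with one effect being close to a multiple of the
identity forces the same for the other effect. Since each measurement changes only one of the two
effects, they stay close to multiples of the identity, where no state is excluded, unless some
overlap becomes large; stopping at that moment, the Cauchy-Schwarz inequality bounds the error from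
below by a constant. Finally, every cut of the three parties separates `A` from `B` or `A` from `C`,
and each of these pairs shares an isometric copy of the domino states.
-/

noncomputable section

namespace GNPS

open Matrix
open scoped NNReal

/-! ### Conservation of probability -/

theorem sq_tsum_le_tsum_mul_tsum {ι : Type*} {f u v : ι → ℝ≥0∞}
    (h : ∀ i, f i ^ 2 ≤ u i * v i) : (∑' i, f i) ^ 2 ≤ (∑' i, u i) * ∑' i, v i := by
  set r : ℝ≥0∞ → ℝ≥0∞ := fun x => x ^ (1 / 2 : ℝ) with hr
  have sq_r (x : ℝ≥0∞) : r x ^ 2 = x := by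
    rw [hr, ← ENNReal.rpow_mul_natCast]
    norm_num
  have r_sq (x : ℝ≥0∞) : r x ^ (2 : ℝ) = x := by rw [ENNReal.rpow_ofNat, sq_r]
  have f_le (i : ι) : f i ≤ r (u i) * r (v i) :=
    (ENNReal.pow_le_pow_left_iff two_ne_zero).1 (by rw [mul_pow, sq_r, sq_r]; exact h i)
  have sum_le (s : Finset ι) : ∑ i ∈ s, f i ≤ r (∑' i, u i) * r (∑' i, v i) :=
    calc ∑ i ∈ s, f i ≤ ∑ i ∈ s, r (u i) * r (v i) := Finset.sum_le_sum fun i _ => f_le i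
      _ ≤ r (∑ i ∈ s, u i) * r (∑ i ∈ s, v i) := by
        simpa only [r_sq] using ENNReal.inner_le_Lp_mul_Lq s (fun i => r (u i))
          (fun i => r (v i)) Real.HolderConjugate.two_two
      _ ≤ r (∑' i, u i) * r (∑' i, v i) := by
        simp only [hr]
        gcongr <;> exact ENNReal.sum_le_tsum s
  calc (∑' i, f i) ^ 2 ≤ (r (∑' i, u i) * r (∑' i, v i)) ^ 2 := by
        gcongr
        exact ENNReal.summable.tsum_le_of_sum_le sum_le
    _ = (∑' i, u i) * ∑' i, v i := by rw [mul_pow, sq_r, sq_r]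

section NormSq

variable {m n m' n' : Type*} [Fintype m] [Fintype n] [Fintype m'] [Fintype n']

/-- The squared norm of a bipartite vector. It is `ℝ≥0∞`-valued because probabilities are. -/
def normSq (ψ : Matrix m n ℂ) : ℝ≥0∞ := ∑ i, ∑ j, ‖ψ i j‖ₑ ^ 2

theorem trace_conjTranspose_mul_self_eq_ofReal (ψ : Matrix m n ℂ) :
    (ψᴴ * ψ).trace = ((∑ i, ∑ j, ‖ψ i j‖ ^ 2 : ℝ) : ℂ) := by
  rw [Finset.sum_comm]
  simp [Matrix.trace, Matrix.mul_apply, RCLike.conj_mul]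

theorem normSq_eq_ofReal (ψ : Matrix m n ℂ) : normSq ψ = ENNReal.ofReal (ψᴴ * ψ).trace.re := by
  rw [trace_conjTranspose_mul_self_eq_ofReal, Complex.ofReal_re,
    ENNReal.ofReal_sum_of_nonneg fun i _ => by positivity]
  refine Finset.sum_congr rfl fun i _ => ?_
  rw [ENNReal.ofReal_sum_of_nonneg fun j _ => by positivity]
  refine Finset.sum_congr rfl fun j _ => ?_
  rw [ENNReal.ofReal_pow (norm_nonneg _), ofReal_norm]

theorem sq_enorm_trace_conjTranspose_mul_le (ψ φ : Matrix m n ℂ) :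
    ‖(ψᴴ * φ).trace‖ₑ ^ 2 ≤ normSq ψ * normSq φ := by
  have trace_eq : (ψᴴ * φ).trace = ∑ p : m × n, star (ψ p.1 p.2) * φ p.1 p.2 := by
    rw [Fintype.sum_prod_type, Finset.sum_comm]
    rfl
  have enorm_le : ‖(ψᴴ * φ).trace‖ₑ ≤ ∑' p : m × n, ‖star (ψ p.1 p.2) * φ p.1 p.2‖ₑ := by
    rw [trace_eq, tsum_fintype]
    exact enorm_sum_le _ _
  have normSq_eq (χ : Matrix m n ℂ) : normSq χ = ∑' p : m × n, ‖χ p.1 p.2‖ₑ ^ 2 := by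
    rw [tsum_fintype, Fintype.sum_prod_type, normSq]
  rw [normSq_eq, normSq_eq]
  refine (by gcongr : _ ≤ _).trans (sq_tsum_le_tsum_mul_tsum fun p => ?_)
  rw [enorm_mul, mul_pow, enorm_eq_nnnorm (star _), nnnorm_star, ← enorm_eq_nnnorm]

/-- The matrix element `⟨ψ|a ⊗ b|φ⟩` of a product operator between two bipartite vectors. -/
def matrixElement (ψ : Matrix m n ℂ) (a : Matrix m m ℂ) (b : Matrix n n ℂ) (φ : Matrix m n ℂ) :
    ℂ := (ψᴴ * a * φ * bᵀ).trace

theorem matrixElement_one_one [DecidableEq m] [DecidableEq n] (ψ φ : Matrix m n ℂ) :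
    matrixElement ψ 1 1 φ = (ψᴴ * φ).trace := by
  simp only [matrixElement, transpose_one, Matrix.mul_one]

theorem matrixElement_conjTranspose_mul_self (ψ φ : Matrix m n ℂ) (K : Matrix m' m ℂ)
    (L : Matrix n' n ℂ) :
    matrixElement ψ (Kᴴ * K) (Lᴴ * L) φ = ((K * ψ * Lᵀ)ᴴ * (K * φ * Lᵀ)).trace := by
  simp only [matrixElement, conjTranspose_mul, transpose_mul, Matrix.mul_assoc]
  rw [Matrix.trace_mul_comm (Lᵀᴴ)]
  simp only [Matrix.mul_assoc]
  rfl

theorem mul_enorm_le_enorm_trace {A : Matrix m' m ℂ} {B : Matrix n' n ℂ} {ψ φ : Matrix m n ℂ}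
    {c : ℝ≥0} {z : ℂ} (hz : c * ‖z‖ ≤ ‖matrixElement ψ (Aᴴ * A) (Bᴴ * B) φ‖) :
    c * ‖z‖ₑ ≤ ‖((A * ψ * Bᵀ)ᴴ * (A * φ * Bᵀ)).trace‖ₑ := by
  rw [← matrixElement_conjTranspose_mul_self]
  simp only [enorm_eq_nnnorm]
  exact_mod_cast hz

theorem normSq_mul_mul_transpose [DecidableEq m] [DecidableEq n] {U : Matrix m' m ℂ}
    {V : Matrix n' n ℂ} (hU : Uᴴ * U = 1) (hV : Vᴴ * V = 1) (ψ : Matrix m n ℂ) :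
    normSq (U * ψ * Vᵀ) = normSq ψ := by
  rw [normSq_eq_ofReal, ← matrixElement_conjTranspose_mul_self, hU, hV, matrixElement_one_one,
    normSq_eq_ofReal]

theorem conjTranspose_mul_self_of_isometry {m k : Type*} [Fintype m] [Fintype k] [DecidableEq k]
    {n : Type*} {U : Matrix m k ℂ} (hU : Uᴴ * U = 1) (A : Matrix k n ℂ) :
    (U * A)ᴴ * (U * A) = Aᴴ * A := by
  rw [conjTranspose_mul, Matrix.mul_assoc, ← Matrix.mul_assoc _ _ A, hU, Matrix.one_mul]

end NormSq

namespace Protocol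

variable {α β : Type} [Fintype α] [Fintype β] [DecidableEq α] [DecidableEq β]
  (P : Protocol α β) (h : List ℕ)

/-- The subnormalized state into which outcome `x` of the step after the record `h` turns `ψ`. -/
def branch (x : ℕ) (ψ : Matrix (Fin (P.dimA h)) (Fin (P.dimB h)) ℂ) :
    Matrix (Fin (P.dimA (x :: h))) (Fin (P.dimB (x :: h))) ℂ :=
  P.krausA h x * ψ * (P.krausB h x)ᵀ

theorem branch_mul_mul_transpose {m n : Type*} [Fintype m] [Fintype n] (x : ℕ)
    (A : Matrix (Fin (P.dimA h)) m ℂ) (ψ : Matrix m n ℂ) (B : Matrix (Fin (P.dimB h)) n ℂ) :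
    P.branch h x (A * ψ * Bᵀ) = P.krausA h x * A * ψ * (P.krausB h x * B)ᵀ := by
  simp only [branch, transpose_mul, Matrix.mul_assoc]

theorem hasSum_bilinear_effects
    (Φ : Matrix (Fin (P.dimA h)) (Fin (P.dimA h)) ℂ →ₗ[ℂ]
      Matrix (Fin (P.dimB h)) (Fin (P.dimB h)) ℂ →ₗ[ℂ] ℂ) :
    HasSum (fun x => Φ ((P.krausA h x)ᴴ * P.krausA h x) ((P.krausB h x)ᴴ * P.krausB h x))
      (Φ 1 1) := by
  rcases P.step h with ⟨measured, isometric⟩ | ⟨measured, isometric⟩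
  · simp only [isometric]
    exact measured.map (Φ.flip 1) (Φ.flip 1).continuous_of_finiteDimensional
  · simp only [isometric]
    exact measured.map (Φ 1) (Φ 1).continuous_of_finiteDimensional

theorem hasSum_trace_branch (ψ φ : Matrix (Fin (P.dimA h)) (Fin (P.dimB h)) ℂ) :
    HasSum (fun x => ((P.branch h x ψ)ᴴ * P.branch h x φ).trace) (ψᴴ * φ).trace := by
  have matrixElement_hasSum : HasSum (fun x => matrixElement ψ ((P.krausA h x)ᴴ * P.krausA h x)
      ((P.krausB h x)ᴴ * P.krausB h x) φ) (matrixElement ψ 1 1 φ) :=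
    P.hasSum_bilinear_effects h (LinearMap.mk₂ ℂ (fun a b => matrixElement ψ a b φ)
      (fun a a' b => by simp [matrixElement, Matrix.mul_add, Matrix.add_mul])
      (fun c a b => by simp [matrixElement])
      (fun a b b' => by simp [matrixElement, Matrix.mul_add])
      (fun c a b => by simp [matrixElement]))
  simpa only [branch, matrixElement_one_one, matrixElement_conjTranspose_mul_self]
    using matrixElement_hasSum

theorem hasSum_trace_mul_trace {m n : Type*} [Fintype m] [Fintype n]
    (A : Matrix (Fin (P.dimA h)) m ℂ) (B : Matrix (Fin (P.dimB h)) n ℂ) :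
    HasSum (fun x => ((P.krausA h x * A)ᴴ * (P.krausA h x * A)).trace *
      ((P.krausB h x * B)ᴴ * (P.krausB h x * B)).trace) ((Aᴴ * A).trace * (Bᴴ * B).trace) := by
  have := P.hasSum_bilinear_effects h
    (LinearMap.mk₂ ℂ (fun a b => (Aᴴ * a * A).trace * (Bᴴ * b * B).trace)
      (fun a a' b => by simp [Matrix.mul_add, Matrix.add_mul, add_mul])
      (fun c a b => by simp [mul_assoc])
      (fun a b b' => by simp [Matrix.mul_add, Matrix.add_mul, mul_add])
      (fun c a b => by simp [mul_left_comm]))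
  simp only [LinearMap.mk₂_apply, Matrix.mul_one] at this
  simpa only [conjTranspose_mul, Matrix.mul_assoc] using this

theorem tsum_normSq_branch (ψ : Matrix (Fin (P.dimA h)) (Fin (P.dimB h)) ℂ) :
    ∑' x, normSq (P.branch h x ψ) = normSq ψ := by
  have hs := Complex.hasSum_re (P.hasSum_trace_branch h ψ ψ)
  simp only [normSq_eq_ofReal]
  rw [← hs.tsum_eq, ENNReal.ofReal_tsum_of_nonneg _ hs.summable]
  intro x
  rw [trace_conjTranspose_mul_self_eq_ofReal, Complex.ofReal_re]
  positivity

variable {h}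

theorem probFrom_add_probFrom_compl (E : Set (List ℕ)) (t : ℕ)
    (ψ : Matrix (Fin (P.dimA h)) (Fin (P.dimB h)) ℂ) :
    P.probFrom E t h ψ + P.probFrom Eᶜ t h ψ = normSq ψ := by
  induction t generalizing h with
  | zero => by_cases hE : h ∈ E <;> simp [probFrom, normSq, hE]
  | succ t ih =>
    calc P.probFrom E (t + 1) h ψ + P.probFrom Eᶜ (t + 1) h ψ
      _ = ∑' x, (P.probFrom E t (x :: h) (P.branch h x ψ) +
            P.probFrom Eᶜ t (x :: h) (P.branch h x ψ)) := ENNReal.tsum_add.symm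
      _ = normSq ψ := by simp only [ih, tsum_normSq_branch]

theorem prob_add_prob_compl (E : Set (List ℕ)) (t : ℕ) (ψ : Matrix α β ℂ) :
    P.prob E t ψ + P.prob Eᶜ t ψ = normSq ψ := by
  rw [prob, prob, probFrom_add_probFrom_compl,
    normSq_mul_mul_transpose P.initA_isometry P.initB_isometry]

theorem tendsto_prob_compl {E : Set (List ℕ)} {ψ : Matrix α β ℂ} (hψ : normSq ψ = 1)
    (hE : Filter.Tendsto (fun t => P.prob E t ψ) Filter.atTop (𝓝 1)) :
    Filter.Tendsto (fun t => P.prob Eᶜ t ψ) Filter.atTop (𝓝 0) := by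
  have prob_compl (t : ℕ) : P.prob Eᶜ t ψ = 1 - P.prob E t ψ := by
    have add_eq_one := (P.prob_add_prob_compl E t ψ).trans hψ
    rw [← add_eq_one, ENNReal.add_sub_cancel_left]
    exact ne_top_of_le_ne_top ENNReal.one_ne_top (le_self_add.trans_eq add_eq_one)
  simpa only [prob_compl, tsub_self] using
    ENNReal.Tendsto.sub tendsto_const_nhds hE (Or.inl ENNReal.one_ne_top)

end Protocol

/-! ### Rigid families of states -/

namespace Protocol

variable {α β : Type} [Fintype α] [Fintype β] [DecidableEq α] [DecidableEq β]
  {ι : Type*} [Fintype ι] (P : Protocol α β) {guess : List ℕ → Option ι} {t : ℕ} {h : List ℕ}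
  {ψ : ι → Matrix (Fin (P.dimA h)) (Fin (P.dimB h)) ℂ}

/-- The sum over `i` of the probabilities that, starting after the record `h` with the state
`ψ i`, the guess after `t` further steps is not `i`. -/
def totalError (guess : List ℕ → Option ι) (t : ℕ) (h : List ℕ)
    (ψ : ι → Matrix (Fin (P.dimA h)) (Fin (P.dimB h)) ℂ) : ℝ≥0∞ :=
  ∑ i, P.probFrom {h | guess h = some i}ᶜ t h (ψ i)

theorem totalError_succ : P.totalError guess (t + 1) h ψ =
    ∑' x, P.totalError guess t (x :: h) fun i => P.branch h x (ψ i) :=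
  (Summable.tsum_finsetSum fun _ _ => ENNReal.summable).symm

theorem sq_enorm_trace_le_of_guess_ne {i : ι} (hi : guess h ≠ some i) (j : ι) :
    ‖((ψ i)ᴴ * ψ j).trace‖ₑ ^ 2 ≤ P.totalError guess 0 h ψ * ∑ k, normSq (ψ k) := by
  have error_eq : P.probFrom {h | guess h = some i}ᶜ 0 h (ψ i) = normSq (ψ i) := by
    simp [probFrom, hi, normSq]
  calc ‖((ψ i)ᴴ * ψ j).trace‖ₑ ^ 2 ≤ normSq (ψ i) * normSq (ψ j) :=
        sq_enorm_trace_conjTranspose_mul_le _ _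
    _ ≤ P.totalError guess 0 h ψ * ∑ k, normSq (ψ k) := by
        rw [← error_eq]
        gcongr
        · exact Finset.single_le_sum_of_canonicallyOrdered (Finset.mem_univ i)
            (f := fun i => P.probFrom {h | guess h = some i}ᶜ 0 h (ψ i))
        · exact Finset.single_le_sum_of_canonicallyOrdered (Finset.mem_univ j)
            (f := fun k => normSq (ψ k))

theorem sq_le_totalError_succ_mul {y : ℝ≥0∞} {f : ℕ → ℝ≥0∞} (hy : y ≤ ∑' x, f x)
    (hf : ∀ x, f x ^ 2 ≤ P.totalError guess t (x :: h) (fun i => P.branch h x (ψ i)) *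
      ∑ i, normSq (P.branch h x (ψ i))) :
    y ^ 2 ≤ P.totalError guess (t + 1) h ψ * ∑ i, normSq (ψ i) := by
  have normSq_eq : ∑ i, normSq (ψ i) = ∑' x, ∑ i, normSq (P.branch h x (ψ i)) := by
    rw [Summable.tsum_finsetSum fun _ _ => ENNReal.summable]
    simp only [tsum_normSq_branch]
  rw [totalError_succ, normSq_eq]
  exact (by gcongr : y ^ 2 ≤ _).trans (sq_tsum_le_tsum_mul_tsum hf)

theorem sq_enorm_trace_le_totalError_mul {i j : ι} (hij : i ≠ j) :
    ‖((ψ i)ᴴ * ψ j).trace‖ₑ ^ 2 ≤ P.totalError guess t h ψ * ∑ k, normSq (ψ k) := by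
  induction t generalizing h with
  | zero =>
    by_cases hi : guess h = some i
    · have hj : guess h ≠ some j := fun hj => hij (Option.some.inj (hi.symm.trans hj))
      rw [enorm_eq_nnnorm, ← nnnorm_star, ← enorm_eq_nnnorm, ← trace_conjTranspose,
        conjTranspose_mul, conjTranspose_conjTranspose]
      exact P.sq_enorm_trace_le_of_guess_ne hj i
    · exact P.sq_enorm_trace_le_of_guess_ne hi j
  | succ t ih =>
    refine P.sq_le_totalError_succ_mul ?_ fun x => ih
    rw [← (P.hasSum_trace_branch h (ψ i) (ψ j)).tsum_eq]
    exact enorm_tsum_le_tsum_enorm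

end Protocol

/-- A quantitative form of local stability for a family of bipartite states: as long as the
effects `a` and `b` accumulated by the two parties keep the states nearly orthogonal, a measurement
by one party alone cannot leave the sets `𝒜` and `ℬ` of effects, and inside these sets every state
still occurs with appreciable probability. -/
structure IsLocallyRigid {ι m n : Type*} [Fintype m] [Fintype n] [DecidableEq m] [DecidableEq n]
    (ψ : ι → Matrix m n ℂ) (𝒜 : Set (Matrix m m ℂ)) (ℬ : Set (Matrix n n ℂ)) (c : ℝ≥0) :
    Prop where
  one_mem_left : 1 ∈ 𝒜
  one_mem_right : 1 ∈ ℬ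
  mem_left : ∀ ⦃a b⦄, a.IsHermitian → b ∈ ℬ →
    (∀ i j, i ≠ j → ‖matrixElement (ψ i) a b (ψ j)‖ < c * ‖a.trace * b.trace‖) → a ∈ 𝒜
  mem_right : ∀ ⦃a b⦄, a ∈ 𝒜 → b.IsHermitian →
    (∀ i j, i ≠ j → ‖matrixElement (ψ i) a b (ψ j)‖ < c * ‖a.trace * b.trace‖) → b ∈ ℬ
  le_norm_self : ∀ ⦃a b⦄, a ∈ 𝒜 → b ∈ ℬ → ∀ i,
    c * ‖a.trace * b.trace‖ ≤ ‖matrixElement (ψ i) a b (ψ i)‖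

namespace IsLocallyRigid

variable {α β : Type} [Fintype α] [Fintype β] [DecidableEq α] [DecidableEq β]
  {ι : Type*} {ψ : ι → Matrix α β ℂ} {𝒜 : Set (Matrix α α ℂ)}
  {ℬ : Set (Matrix β β ℂ)} {c : ℝ≥0}

theorem effect_mem_of_matrixElement_lt (hψ : IsLocallyRigid ψ 𝒜 ℬ c) (P : Protocol α β)
    {h : List ℕ} {x : ℕ} {A : Matrix (Fin (P.dimA h)) α ℂ} {B : Matrix (Fin (P.dimB h)) β ℂ}
    (hA : Aᴴ * A ∈ 𝒜) (hB : Bᴴ * B ∈ ℬ)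
    (stable : ∀ i j, i ≠ j →
      ‖matrixElement (ψ i) ((P.krausA h x * A)ᴴ * (P.krausA h x * A))
          ((P.krausB h x * B)ᴴ * (P.krausB h x * B)) (ψ j)‖ <
        c * ‖((P.krausA h x * A)ᴴ * (P.krausA h x * A)).trace *
          ((P.krausB h x * B)ᴴ * (P.krausB h x * B)).trace‖) :
    (P.krausA h x * A)ᴴ * (P.krausA h x * A) ∈ 𝒜 ∧
      (P.krausB h x * B)ᴴ * (P.krausB h x * B) ∈ ℬ := by
  rcases P.step h with ⟨-, isometric⟩ | ⟨-, isometric⟩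
  · have memB : (P.krausB h x * B)ᴴ * (P.krausB h x * B) ∈ ℬ := by
      rwa [conjTranspose_mul_self_of_isometry (isometric x)]
    exact ⟨hψ.mem_left (isHermitian_conjTranspose_mul_self _) memB stable, memB⟩
  · have memA : (P.krausA h x * A)ᴴ * (P.krausA h x * A) ∈ 𝒜 := by
      rwa [conjTranspose_mul_self_of_isometry (isometric x)]
    exact ⟨memA, hψ.mem_right memA (isHermitian_conjTranspose_mul_self _) stable⟩

theorem sq_trace_mul_trace_le [Fintype ι] [Nontrivial ι] (hψ : IsLocallyRigid ψ 𝒜 ℬ c)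
    (P : Protocol α β) (guess : List ℕ → Option ι) (t : ℕ) {h : List ℕ}
    {A : Matrix (Fin (P.dimA h)) α ℂ} {B : Matrix (Fin (P.dimB h)) β ℂ}
    (hA : Aᴴ * A ∈ 𝒜) (hB : Bᴴ * B ∈ ℬ) :
    (c * ‖(Aᴴ * A).trace * (Bᴴ * B).trace‖ₑ) ^ 2 ≤
      P.totalError guess t h (fun i => A * ψ i * Bᵀ) * ∑ i, normSq (A * ψ i * Bᵀ) := by
  induction t generalizing h with
  | zero =>
    obtain ⟨i, hi⟩ : ∃ i, guess h ≠ some i := by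
      obtain ⟨i, j, hij⟩ := exists_pair_ne ι
      by_contra! guessed
      exact hij (Option.some.inj ((guessed i).symm.trans (guessed j)))
    refine le_trans ?_ (P.sq_enorm_trace_le_of_guess_ne (ψ := fun i => A * ψ i * Bᵀ) hi i)
    gcongr
    exact mul_enorm_le_enorm_trace (hψ.le_norm_self hA hB i)
  | succ t ih =>
    refine P.sq_le_totalError_succ_mul (f := fun x =>
      c * ‖((P.krausA h x * A)ᴴ * (P.krausA h x * A)).trace *
        ((P.krausB h x * B)ᴴ * (P.krausB h x * B)).trace‖ₑ) ?_ fun x => ?_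
    · rw [← (P.hasSum_trace_mul_trace h A B).tsum_eq, ENNReal.tsum_mul_left]
      gcongr
      exact enorm_tsum_le_tsum_enorm
    simp only [P.branch_mul_mul_transpose]
    set A' := P.krausA h x * A
    set B' := P.krausB h x * B
    by_cases stable : ∀ i j, i ≠ j → ‖matrixElement (ψ i) (A'ᴴ * A') (B'ᴴ * B') (ψ j)‖ <
        c * ‖(A'ᴴ * A').trace * (B'ᴴ * B').trace‖
    · obtain ⟨memA, memB⟩ := hψ.effect_mem_of_matrixElement_lt P hA hB stable
      exact ih memA memB
    · push Not at stable
      obtain ⟨i, j, hij, overlapping⟩ := stable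
      refine le_trans ?_
        (P.sq_enorm_trace_le_totalError_mul (ψ := fun i => A' * ψ i * B'ᵀ) hij)
      gcongr
      exact mul_enorm_le_enorm_trace overlapping

theorem not_perfectlyDiscriminable [Finite ι] [Nontrivial ι] [Nonempty α] [Nonempty β]
    (hψ : IsLocallyRigid ψ 𝒜 ℬ c) (hc : c ≠ 0) (normalized : ∀ i, normSq (ψ i) = 1) :
    ¬ PerfectlyDiscriminable ψ := by
  cases nonempty_fintype ι
  rintro ⟨P, guess, correct⟩
  have bound (t : ℕ) : (c * ‖(Fintype.card α * Fintype.card β : ℂ)‖ₑ) ^ 2 ≤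
      (∑ i, P.prob {h | guess h = some i}ᶜ t (ψ i)) * Fintype.card ι := by
    have := hψ.sq_trace_mul_trace_le P guess t (A := P.initA) (B := P.initB)
      (P.initA_isometry ▸ hψ.one_mem_left) (P.initB_isometry ▸ hψ.one_mem_right)
    simpa [Protocol.totalError, Protocol.prob, P.initA_isometry, P.initB_isometry, normalized,
      normSq_mul_mul_transpose P.initA_isometry P.initB_isometry] using this
  have error_tendsto : Filter.Tendsto
      (fun t => (∑ i, P.prob {h | guess h = some i}ᶜ t (ψ i)) * Fintype.card ι)
      Filter.atTop (𝓝 0) := by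
    simpa using ENNReal.Tendsto.mul_const (b := (Fintype.card ι : ℝ≥0∞))
      (tendsto_finsetSum Finset.univ fun i _ =>
        P.tendsto_prob_compl (normalized i) (correct i)) (Or.inr (ENNReal.natCast_ne_top _))
  have sq_eq_zero := le_zero_iff.1 (ge_of_tendsto' error_tendsto bound)
  simp [hc, Fintype.card_ne_zero] at sq_eq_zero

end IsLocallyRigid

/-! ### Operations that preserve discriminability -/

namespace Protocol

variable {α β α' β' : Type} [Fintype α] [Fintype β] [DecidableEq α] [DecidableEq β]
  [Fintype α'] [Fintype β'] [DecidableEq α'] [DecidableEq β']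

/-- The protocol that embeds the two systems by the isometries `X` and `Y` and continues with
`P`. -/
def comapIsometry (P : Protocol α' β') {X : Matrix α' α ℂ} {Y : Matrix β' β ℂ} (hX : Xᴴ * X = 1)
    (hY : Yᴴ * Y = 1) : Protocol α β where
  dimA := P.dimA
  dimB := P.dimB
  initA := P.initA * X
  initB := P.initB * Y
  initA_isometry := (conjTranspose_mul_self_of_isometry P.initA_isometry X).trans hX
  initB_isometry := (conjTranspose_mul_self_of_isometry P.initB_isometry Y).trans hY
  krausA := P.krausA
  krausB := P.krausB
  step := P.step

theorem prob_comapIsometry (P : Protocol α' β') {X : Matrix α' α ℂ} {Y : Matrix β' β ℂ}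
    (hX : Xᴴ * X = 1) (hY : Yᴴ * Y = 1) (E : Set (List ℕ)) (t : ℕ) (ψ : Matrix α β ℂ) :
    (P.comapIsometry hX hY).prob E t ψ = P.prob E t (X * ψ * Yᵀ) := by
  have probFrom_eq (t : ℕ) (h : List ℕ) (φ : Matrix (Fin (P.dimA h)) (Fin (P.dimB h)) ℂ) :
      (P.comapIsometry hX hY).probFrom E t h φ = P.probFrom E t h φ := by
    induction t generalizing h with
    | zero => rfl
    | succ t ih => exact tsum_congr fun x => ih (x :: h) _
  rw [prob, prob]
  have embed_eq : P.initA * X * ψ * (P.initB * Y)ᵀ = P.initA * (X * ψ * Yᵀ) * P.initBᵀ := by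
    simp only [transpose_mul, Matrix.mul_assoc]
  exact (probFrom_eq t [] _).trans (congrArg (P.probFrom E t []) embed_eq)

/-- The protocol with the roles of the two parties exchanged. -/
def swap (P : Protocol α β) : Protocol β α where
  dimA := P.dimB
  dimB := P.dimA
  initA := P.initB
  initB := P.initA
  initA_isometry := P.initB_isometry
  initB_isometry := P.initA_isometry
  krausA := P.krausB
  krausB := P.krausA
  step h := (P.step h).symm

theorem prob_swap (P : Protocol α β) (E : Set (List ℕ)) (t : ℕ) (ψ : Matrix α β ℂ) :
    P.swap.prob E t ψᵀ = P.prob E t ψ := by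
  have transpose_eq {k l m n : Type} [Fintype l] [Fintype m] (A : Matrix k l ℂ) (φ : Matrix l m ℂ)
      (B : Matrix n m ℂ) : B * φᵀ * Aᵀ = (A * φ * Bᵀ)ᵀ := by
    simp only [transpose_mul, transpose_transpose, Matrix.mul_assoc]
  have probFrom_eq (t : ℕ) (h : List ℕ) (φ : Matrix (Fin (P.dimA h)) (Fin (P.dimB h)) ℂ) :
      P.swap.probFrom E t h φᵀ = P.probFrom E t h φ := by
    induction t generalizing h with
    | zero =>
      classical exact if_congr Iff.rfl Finset.sum_comm rfl
    | succ t ih =>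
      refine tsum_congr fun x => ?_
      rw [← ih (x :: h)]
      exact congrArg (P.swap.probFrom E t (x :: h)) (transpose_eq _ _ _)
  rw [prob, prob, ← probFrom_eq]
  exact congrArg (P.swap.probFrom E t []) (transpose_eq _ _ _)

end Protocol

namespace PerfectlyDiscriminable

variable {α β α' β' : Type} [Fintype α] [Fintype β] [DecidableEq α] [DecidableEq β]
  [Fintype α'] [Fintype β'] [DecidableEq α'] [DecidableEq β']
  {ι κ : Type*} {ψ : κ → Matrix α' β' ℂ} {φ : ι → Matrix α β ℂ}

theorem transpose (h : PerfectlyDiscriminable φ) :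
    PerfectlyDiscriminable fun i => (φ i)ᵀ := by
  obtain ⟨P, guess, correct⟩ := h
  exact ⟨P.swap, guess, fun i => by simpa only [Protocol.prob_swap] using correct i⟩

theorem comp_injective (h : PerfectlyDiscriminable φ) {f : κ → ι} (hf : Function.Injective f) :
    PerfectlyDiscriminable (φ ∘ f) := by
  obtain ⟨P, guess, correct⟩ := h
  refine ⟨P, fun h => (guess h).bind (Function.partialInv f), fun k => ?_⟩
  have event_eq : {h | (guess h).bind (Function.partialInv f) = some k} =
      {h | guess h = some (f k)} := by
    ext h
    simp [Option.bind_eq_some_iff, hf.isPartialInv _ _]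
  exact event_eq ▸ correct (f k)

theorem of_isometry {X : Matrix α' α ℂ} {Y : Matrix β' β ℂ} (hX : Xᴴ * X = 1) (hY : Yᴴ * Y = 1)
    (h : PerfectlyDiscriminable fun i => X * φ i * Yᵀ) : PerfectlyDiscriminable φ := by
  obtain ⟨P, guess, correct⟩ := h
  exact ⟨P.comapIsometry hX hY, guess, fun i => by
    simpa only [Protocol.prob_comapIsometry] using correct i⟩

theorem of_isometric_copy (h : PerfectlyDiscriminable ψ) {X : Matrix α' α ℂ} {Y : Matrix β' β ℂ}
    (hX : Xᴴ * X = 1) (hY : Yᴴ * Y = 1) (hφ : Function.Injective φ)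
    (copy : ∀ i, ∃ k, ψ k = X * φ i * Yᵀ) : PerfectlyDiscriminable φ := by
  choose f hf using copy
  have cancel (M : Matrix α β ℂ) : Xᴴ * (X * M * Yᵀ) * Yᴴᵀ = M := by
    simp only [Matrix.mul_assoc]
    rw [← transpose_mul, hY, transpose_one, Matrix.mul_one, ← Matrix.mul_assoc, hX, Matrix.one_mul]
  have f_injective : Function.Injective f := fun i j hij => hφ <| by
    rw [← cancel (φ i), ← hf i, hij, hf j, cancel]
  refine of_isometry hX hY ?_
  simpa only [Function.comp_def, hf] using h.comp_injective f_injective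

end PerfectlyDiscriminable

/-! ### The domino states -/

theorem matrixElement_smul_smul {m n : Type*} [Fintype m] [Fintype n] (z w : ℂ)
    (ψ φ : Matrix m n ℂ) (a : Matrix m m ℂ) (b : Matrix n n ℂ) :
    matrixElement (z • ψ) a b (w • φ) = star z * w * matrixElement ψ a b φ := by
  simp [matrixElement, mul_left_comm, mul_assoc]

theorem matrixElement_vecMulVec {m n : Type*} [Fintype m] [Fintype n] (a : Matrix m m ℂ)
    (b : Matrix n n ℂ) (u u' : m → ℂ) (v v' : n → ℂ) :
    matrixElement (vecMulVec u v) a b (vecMulVec u' v') =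
      (star u ⬝ᵥ a *ᵥ u') * (star v ⬝ᵥ b *ᵥ v') := by
  rw [matrixElement, conjTranspose_vecMulVec, vecMulVec_mul, vecMulVec_mul_vecMulVec,
    vecMulVec_mul, smul_vecMul, trace_vecMulVec, dotProduct_smul, smul_eq_mul, vecMul_transpose,
    ← dotProduct_mulVec]

section IsNearScalar

variable {n : Type*} [Fintype n] {δ : ℝ} {a : Matrix n n ℂ}

/-- The matrix `a` is close to a multiple of the identity: relative to the trace, its off-diagonal
entries and the differences of its diagonal entries are at most `δ`. -/
structure IsNearScalar (δ : ℝ) (a : Matrix n n ℂ) : Prop where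
  norm_offDiag_le : ∀ k l, k ≠ l → ‖a k l‖ ≤ δ * ‖a.trace‖
  norm_diag_sub_le : ∀ k l, ‖a k k - a l l‖ ≤ δ * ‖a.trace‖

theorem isNearScalar_one [DecidableEq n] (hδ : 0 ≤ δ) :
    IsNearScalar δ (1 : Matrix n n ℂ) where
  norm_offDiag_le k l hkl := by
    rw [one_apply_ne hkl, norm_zero]
    positivity
  norm_diag_sub_le k l := by
    rw [one_apply_eq, one_apply_eq, sub_self, norm_zero]
    positivity

theorem trace_submatrix_equiv {m : Type*} [Fintype m] (e : m ≃ n) :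
    (a.submatrix e e).trace = a.trace :=
  e.sum_comp fun k => a k k

theorem IsNearScalar.submatrix_equiv {m : Type*} [Fintype m] (ha : IsNearScalar δ a)
    (e : m ≃ n) : IsNearScalar δ (a.submatrix e e) where
  norm_offDiag_le k l hkl := by
    rw [trace_submatrix_equiv]
    exact ha.norm_offDiag_le _ _ (e.injective.ne hkl)
  norm_diag_sub_le k l := by
    rw [trace_submatrix_equiv]
    exact ha.norm_diag_sub_le _ _

theorem IsNearScalar.norm_trace_le (ha : IsNearScalar δ a) (k : n) :
    ‖a.trace‖ ≤ Fintype.card n * (‖a k k‖ + δ * ‖a.trace‖) :=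
  calc ‖a.trace‖ ≤ ∑ l, ‖a l l‖ := norm_sum_le _ _
    _ ≤ ∑ _l : n, (‖a k k‖ + δ * ‖a.trace‖) := by
      refine Finset.sum_le_sum fun l _ => ?_
      linarith [norm_le_norm_add_norm_sub' (a l l) (a k k), ha.norm_diag_sub_le l k]
    _ = Fintype.card n * (‖a k k‖ + δ * ‖a.trace‖) := by
      rw [Finset.sum_const, Finset.card_univ, nsmul_eq_mul]

end IsNearScalar

theorem norm_diag_sub_le_of_isHermitian {n : Type*} {a : Matrix n n ℂ} (ha : a.IsHermitian)
    (k l : n) :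
    ‖a k k - a l l‖ ≤ ‖a k k - a k l + a l k - a l l‖ := by
  have star_diag (j : n) : star (a j j) = a j j := ha.apply j j
  have two_mul_sub : 2 * (a k k - a l l) =
      (a k k - a k l + a l k - a l l) + star (a k k - a k l + a l k - a l l) := by
    simp only [star_sub, star_add, star_diag, ha.apply]
    ring
  have norm_two_mul_le := norm_add_le (a k k - a k l + a l k - a l l)
    (star (a k k - a k l + a l k - a l l))
  rw [← two_mul_sub, norm_mul, norm_star, Complex.norm_ofNat] at norm_two_mul_le
  linarith

theorem one_div_sqrt_two_mul_self : ((1 / √2 : ℝ) : ℂ) * ((1 / √2 : ℝ) : ℂ) = 1 / 2 := by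
  rw [← Complex.ofReal_mul, div_mul_div_comm, one_mul, Real.mul_self_sqrt zero_le_two,
    Complex.ofReal_div, Complex.ofReal_one, Complex.ofReal_ofNat]

theorem norm_sign (s : ℤˣ) : ‖((s : ℤ) : ℂ)‖ = 1 := by
  rcases Int.units_eq_one_or s with rfl | rfl <;> simp

theorem sign_mul_sign (s : ℤˣ) : ((s : ℤ) : ℂ) * ((s : ℤ) : ℂ) = 1 := by
  rcases Int.units_eq_one_or s with rfl | rfl <;> simp

theorem norm_le_of_norm_add_sign_mul_le {z w : ℂ} {r : ℝ}
    (h : ∀ s : ℤˣ, ‖z + ((s : ℤ) : ℂ) * w‖ ≤ r) : ‖z‖ ≤ r ∧ ‖w‖ ≤ r := by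
  have add_le : ‖z + w‖ ≤ r := by simpa using h 1
  have sub_le : ‖z - w‖ ≤ r := by simpa [sub_eq_add_neg] using h (-1)
  have two_mul_z := norm_add_le (z + w) (z - w)
  have two_mul_w := norm_sub_le (z + w) (z - w)
  rw [show z + w + (z - w) = 2 * z by ring, norm_mul, Complex.norm_ofNat] at two_mul_z
  rw [show z + w - (z - w) = 2 * w by ring, norm_mul, Complex.norm_ofNat] at two_mul_w
  constructor <;> linarith

/-- The local vectors of the domino states on `ℂ³ ⊗ ℂ³`, up to normalization. The index consists
of one of four tiles and a sign. -/
def tile (i : Fin 4 × ℤˣ) : Fin 3 → ℂ :=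
  ![![1, ((i.2 : ℤ) : ℂ), 0], ![0, 0, 1], ![0, 1, ((i.2 : ℤ) : ℂ)], ![1, 0, 0]] i.1

/-- The next of the four tiles in cyclic order, with the same sign. -/
def next : Fin 4 × ℤˣ ≃ Fin 4 × ℤˣ := (Equiv.addRight 1).prodCongr (Equiv.refl _)

/-- The domino states: eight orthonormal product states of `ℂ³ ⊗ ℂ³`. The cyclic indexing makes
the quarter turn of the tiling, which exchanges the two parties, act as `next`. -/
def domino (i : Fin 4 × ℤˣ) : Matrix (Fin 3) (Fin 3) ℂ :=
  ((1 / √2 : ℝ) : ℂ) • vecMulVec (tile i) (tile (next i))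

/-- The matrix element `⟨i|a|j⟩` between two vectors of the domino states. -/
def tileForm (a : Matrix (Fin 3) (Fin 3) ℂ) (i j : Fin 4 × ℤˣ) : ℂ :=
  star (tile i) ⬝ᵥ a *ᵥ tile j

theorem tileForm_zero_zero (a : Matrix (Fin 3) (Fin 3) ℂ) (s t : ℤˣ) :
    tileForm a (0, s) (0, t) =
      a 0 0 + ((t : ℤ) : ℂ) * a 0 1 + ((s : ℤ) : ℂ) * a 1 0 +
        ((s : ℤ) : ℂ) * ((t : ℤ) : ℂ) * a 1 1 := by
  simp only [tileForm, tile, dotProduct, mulVec, Fin.sum_univ_three, Pi.star_apply,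
    RCLike.star_def, cons_val, map_one, map_zero, map_intCast]
  ring

theorem tileForm_two_two (a : Matrix (Fin 3) (Fin 3) ℂ) (s t : ℤˣ) :
    tileForm a (2, s) (2, t) =
      a 1 1 + ((t : ℤ) : ℂ) * a 1 2 + ((s : ℤ) : ℂ) * a 2 1 +
        ((s : ℤ) : ℂ) * ((t : ℤ) : ℂ) * a 2 2 := by
  simp only [tileForm, tile, dotProduct, mulVec, Fin.sum_univ_three, Pi.star_apply,
    RCLike.star_def, cons_val, map_one, map_zero, map_intCast]
  ring

theorem matrixElement_domino (a b : Matrix (Fin 3) (Fin 3) ℂ) (i j : Fin 4 × ℤˣ) :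
    matrixElement (domino i) a b (domino j) =
      1 / 2 * (tileForm a i j * tileForm b (next i) (next j)) := by
  rw [domino, domino, matrixElement_smul_smul, matrixElement_vecMulVec, Complex.star_def,
    Complex.conj_ofReal, one_div_sqrt_two_mul_self, tileForm, tileForm]

theorem tile_next_next (i : Fin 4 × ℤˣ) :
    ∃ ε : ℂ, ‖ε‖ = 1 ∧ tile (next (next i)) = ε • (tile i ∘ Fin.revPerm) := by
  obtain ⟨i, s⟩ := i
  fin_cases i
  · refine ⟨_, norm_sign s, ?_⟩
    ext k; fin_cases k <;> simp [tile, next, sign_mul_sign]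
  · refine ⟨1, norm_one, ?_⟩
    ext k; fin_cases k <;> simp [tile, next]
  · refine ⟨_, norm_sign s, ?_⟩
    ext k; fin_cases k <;> simp [tile, next, sign_mul_sign]
  · refine ⟨1, norm_one, ?_⟩
    ext k; fin_cases k <;> simp [tile, next]

theorem norm_tileForm_submatrix_rev (a : Matrix (Fin 3) (Fin 3) ℂ) (i j : Fin 4 × ℤˣ) :
    ‖tileForm (a.submatrix Fin.revPerm Fin.revPerm) (next (next i)) (next (next j))‖ =
      ‖tileForm a i j‖ := by
  obtain ⟨ε, norm_ε, tile_i⟩ := tile_next_next i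
  obtain ⟨ζ, norm_ζ, tile_j⟩ := tile_next_next j
  have star_comp : star (tile i ∘ Fin.revPerm) = star (tile i) ∘ Fin.revPerm := rfl
  rw [tileForm, tile_i, tile_j, mulVec_smul, star_smul, smul_dotProduct, dotProduct_smul, norm_smul,
    norm_smul, norm_star, norm_ε, norm_ζ, one_mul, one_mul, submatrix_mulVec_equiv, star_comp,
    comp_equiv_dotProduct_comp_equiv, Function.comp_assoc, Equiv.self_comp_symm, Function.comp_id,
    tileForm]

theorem matrixElement_domino_one_one (i j : Fin 4 × ℤˣ) :
    matrixElement (domino i) 1 1 (domino j) = if i = j then 1 else 0 := by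
  obtain ⟨i, s⟩ := i
  obtain ⟨j, t⟩ := j
  rw [matrixElement_domino]
  rcases Int.units_eq_one_or s with rfl | rfl <;> rcases Int.units_eq_one_or t with rfl | rfl <;>
    fin_cases i <;> fin_cases j <;>
    simp [tileForm, tile, next, dotProduct, Fin.sum_univ_three, one_add_one_eq_two]

theorem normSq_domino (i : Fin 4 × ℤˣ) : normSq (domino i) = 1 := by
  rw [normSq_eq_ofReal, ← matrixElement_one_one, matrixElement_domino_one_one, if_pos rfl,
    Complex.one_re, ENNReal.ofReal_one]

theorem domino_injective : Function.Injective domino := by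
  intro i j hij
  by_contra hne
  have orthogonal := matrixElement_domino_one_one i j
  rw [← hij, matrixElement_domino_one_one, if_pos rfl, if_neg hne] at orthogonal
  exact one_ne_zero orthogonal

section

variable {a b : Matrix (Fin 3) (Fin 3) ℂ}

theorem isNearScalar_of_norm_tileForm_le {δ : ℝ} (ha : a.IsHermitian)
    (h₀ : ‖tileForm a (0, 1) (0, -1)‖ ≤ δ * ‖a.trace‖)
    (h₂ : ‖tileForm a (2, 1) (2, -1)‖ ≤ δ * ‖a.trace‖)
    (h₁₀ : ∀ s, ‖tileForm a (1, 1) (0, s)‖ ≤ δ * ‖a.trace‖)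
    (h₃₂ : ∀ s, ‖tileForm a (3, 1) (2, s)‖ ≤ δ * ‖a.trace‖) : IsNearScalar (2 * δ) a := by
  have norm_symm (k l : Fin 3) : ‖a l k‖ = ‖a k l‖ := by rw [← ha.apply, norm_star]
  have diag₀₁ : ‖a 0 0 - a 1 1‖ ≤ δ * ‖a.trace‖ := by
    refine (norm_diag_sub_le_of_isHermitian ha 0 1).trans ?_
    simpa [tileForm_zero_zero, ← sub_eq_add_neg] using h₀
  have diag₁₂ : ‖a 1 1 - a 2 2‖ ≤ δ * ‖a.trace‖ := by
    refine (norm_diag_sub_le_of_isHermitian ha 1 2).trans ?_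
    simpa [tileForm_two_two, ← sub_eq_add_neg] using h₂
  have offDiag₂ : ‖a 2 0‖ ≤ δ * ‖a.trace‖ ∧ ‖a 2 1‖ ≤ δ * ‖a.trace‖ :=
    norm_le_of_norm_add_sign_mul_le fun s => by
      simpa [tileForm, tile, mulVec, dotProduct, Fin.sum_univ_three, mul_comm] using h₁₀ s
  have offDiag₀ : ‖a 0 1‖ ≤ δ * ‖a.trace‖ ∧ ‖a 0 2‖ ≤ δ * ‖a.trace‖ :=
    norm_le_of_norm_add_sign_mul_le fun s => by
      simpa [tileForm, tile, mulVec, dotProduct, Fin.sum_univ_three, mul_comm] using h₃₂ s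
  have diag₀₂ : ‖a 0 0 - a 2 2‖ ≤ 2 * δ * ‖a.trace‖ := by
    linarith [norm_sub_le_norm_sub_add_norm_sub (a 0 0) (a 1 1) (a 2 2)]
  have bound_nonneg : 0 ≤ δ * ‖a.trace‖ := (norm_nonneg _).trans h₀
  have symm_diag (k l : Fin 3) : ‖a k k - a l l‖ = ‖a l l - a k k‖ := norm_sub_rev _ _
  constructor
  · intro k l hkl
    fin_cases k <;> fin_cases l <;>
      simp only [Fin.zero_eta, Fin.mk_one, Fin.reduceFinMk] at hkl ⊢ <;>
      first
        | exact absurd rfl hkl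
        | linarith [norm_symm 0 1, norm_symm 0 2, norm_symm 1 2]
  · intro k l
    fin_cases k <;> fin_cases l <;>
      simp only [Fin.zero_eta, Fin.mk_one, Fin.reduceFinMk, sub_self, norm_zero] <;>
      linarith [symm_diag 0 1, symm_diag 0 2, symm_diag 1 2]

theorem IsNearScalar.le_norm_diag_add (ha : IsNearScalar (1 / 12) a) (k : Fin 3) {z : ℂ}
    (hz : ‖z‖ ≤ 1 / 12 * ‖a.trace‖) : ‖a.trace‖ / 6 ≤ ‖a k k + z‖ := by
  have norm_trace_le := ha.norm_trace_le k
  have norm_diag_le := norm_sub_le (a k k + z) z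
  rw [Fintype.card_fin, Nat.cast_ofNat] at norm_trace_le
  rw [add_sub_cancel_right] at norm_diag_le
  linarith

theorem IsNearScalar.le_norm_diag (ha : IsNearScalar (1 / 12) a) (k : Fin 3) :
    ‖a.trace‖ / 6 ≤ ‖a k k‖ := by
  simpa only [add_zero] using ha.le_norm_diag_add k (z := 0) (by rw [norm_zero]; positivity)

theorem IsNearScalar.le_norm_diag_pair (ha : IsNearScalar (1 / 12) a) {k l : Fin 3} (hkl : k ≠ l)
    (s : ℤˣ) :
    ‖a.trace‖ / 6 ≤ ‖a k k + ((s : ℤ) : ℂ) * a k l + ((s : ℤ) : ℂ) * a l k + a l l‖ := by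
  have norm_perturbation : ‖((s : ℤ) : ℂ) * (a k l + a l k) - (a k k - a l l)‖ ≤
      3 * (1 / 12 * ‖a.trace‖) := by
    have sub_le := norm_sub_le (((s : ℤ) : ℂ) * (a k l + a l k)) (a k k - a l l)
    rw [norm_mul, norm_sign, one_mul] at sub_le
    linarith [norm_add_le (a k l) (a l k), ha.norm_offDiag_le k l hkl,
      ha.norm_offDiag_le l k hkl.symm, ha.norm_diag_sub_le k l]
  have norm_trace_le := ha.norm_trace_le k
  have two_mul_le := norm_sub_le
    (a k k + ((s : ℤ) : ℂ) * a k l + ((s : ℤ) : ℂ) * a l k + a l l)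
    (((s : ℤ) : ℂ) * (a k l + a l k) - (a k k - a l l))
  rw [Fintype.card_fin, Nat.cast_ofNat] at norm_trace_le
  rw [show a k k + ((s : ℤ) : ℂ) * a k l + ((s : ℤ) : ℂ) * a l k + a l l -
    (((s : ℤ) : ℂ) * (a k l + a l k) - (a k k - a l l)) = 2 * a k k by ring, norm_mul,
    Complex.norm_ofNat] at two_mul_le
  linarith [norm_nonneg a.trace]

theorem IsNearScalar.le_norm_tileForm_self (ha : IsNearScalar (1 / 12) a) (i : Fin 4 × ℤˣ) :
    ‖a.trace‖ / 6 ≤ ‖tileForm a i i‖ := by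
  obtain ⟨i, s⟩ := i
  fin_cases i
  · simpa [tileForm_zero_zero, sign_mul_sign] using
      ha.le_norm_diag_pair (k := 0) (l := 1) (by decide) s
  · simpa [tileForm, tile, mulVec, dotProduct, Fin.sum_univ_three] using ha.le_norm_diag 2
  · simpa [tileForm_two_two, sign_mul_sign] using
      ha.le_norm_diag_pair (k := 1) (l := 2) (by decide) s
  · simpa [tileForm, tile, mulVec, dotProduct, Fin.sum_univ_three] using ha.le_norm_diag 0

theorem norm_tileForm_le_of_matrixElement_lt {i j : Fin 4 × ℤˣ}
    (hb : ‖b.trace‖ / 6 ≤ ‖tileForm b (next i) (next j)‖)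
    (small : ‖matrixElement (domino i) a b (domino j)‖ < 1 / 288 * ‖a.trace * b.trace‖) :
    ‖tileForm a i j‖ ≤ 1 / 24 * ‖a.trace‖ := by
  rw [matrixElement_domino, norm_mul, norm_mul, norm_mul, norm_div, norm_one,
    Complex.norm_ofNat] at small
  have trace_b_pos : 0 < ‖b.trace‖ := by
    refine (norm_nonneg _).lt_of_ne fun trace_b => ?_
    rw [← trace_b, mul_zero, mul_zero] at small
    exact small.not_ge (by positivity)
  have := mul_le_mul_of_nonneg_left hb (norm_nonneg (tileForm a i j))
  refine le_of_mul_le_mul_right ?_ trace_b_pos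
  linarith

theorem isNearScalar_left_of_matrixElement_lt (ha : a.IsHermitian) (hb : IsNearScalar (1 / 12) b)
    (small : ∀ i j, i ≠ j →
      ‖matrixElement (domino i) a b (domino j)‖ < 1 / 288 * ‖a.trace * b.trace‖) :
    IsNearScalar (1 / 12) a := by
  have near : IsNearScalar (2 * (1 / 24)) a := by
    refine isNearScalar_of_norm_tileForm_le ha ?_ ?_ (fun s => ?_) fun s => ?_ <;>
      refine norm_tileForm_le_of_matrixElement_lt ?_ (small _ _ (by simp))
    · simpa [tileForm, tile, next, mulVec, dotProduct, Fin.sum_univ_three] using hb.le_norm_diag 2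
    · simpa [tileForm, tile, next, mulVec, dotProduct, Fin.sum_univ_three] using hb.le_norm_diag 0
    · simpa [tileForm, tile, next, mulVec, dotProduct, Fin.sum_univ_three, add_comm] using
        hb.le_norm_diag_add 2 (hb.norm_offDiag_le 1 2 (by decide))
    · simpa [tileForm, tile, next, mulVec, dotProduct, Fin.sum_univ_three] using
        hb.le_norm_diag_add 0 (hb.norm_offDiag_le 1 0 (by decide))
  norm_num at near
  exact near

theorem norm_matrixElement_domino_next (i j : Fin 4 × ℤˣ) :
    ‖matrixElement (domino (next i)) b (a.submatrix Fin.revPerm Fin.revPerm) (domino (next j))‖ =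
      ‖matrixElement (domino i) a b (domino j)‖ := by
  rw [matrixElement_domino, matrixElement_domino, norm_mul, norm_mul, norm_mul, norm_mul,
    norm_tileForm_submatrix_rev, mul_comm ‖tileForm b _ _‖]

theorem isNearScalar_right_of_matrixElement_lt (ha : IsNearScalar (1 / 12) a) (hb : b.IsHermitian)
    (small : ∀ i j, i ≠ j →
      ‖matrixElement (domino i) a b (domino j)‖ < 1 / 288 * ‖a.trace * b.trace‖) :
    IsNearScalar (1 / 12) b := by
  refine isNearScalar_left_of_matrixElement_lt hb (ha.submatrix_equiv Fin.revPerm) ?_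
  refine next.surjective.forall.2 fun i => next.surjective.forall.2 fun j hij => ?_
  rw [norm_matrixElement_domino_next, trace_submatrix_equiv, mul_comm b.trace]
  exact small i j fun h => hij (congrArg next h)

end

theorem isLocallyRigid_domino :
    IsLocallyRigid domino {a | IsNearScalar (1 / 12) a} {b | IsNearScalar (1 / 12) b}
      (1 / 288) where
  one_mem_left := isNearScalar_one (by norm_num)
  one_mem_right := isNearScalar_one (by norm_num)
  mem_left a b ha hb small := isNearScalar_left_of_matrixElement_lt ha hb (by simpa using small)
  mem_right a b ha hb small := isNearScalar_right_of_matrixElement_lt ha hb (by simpa using small)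
  le_norm_self a b ha hb i := by
    have product_le := mul_le_mul (IsNearScalar.le_norm_tileForm_self ha i)
      (IsNearScalar.le_norm_tileForm_self hb (next i)) (by positivity) (norm_nonneg _)
    have := mul_nonneg (norm_nonneg a.trace) (norm_nonneg b.trace)
    rw [matrixElement_domino, norm_mul, norm_mul, norm_mul, norm_div, norm_one, Complex.norm_ofNat]
    push_cast
    linarith

theorem not_perfectlyDiscriminable_domino : ¬ PerfectlyDiscriminable domino :=
  isLocallyRigid_domino.not_perfectlyDiscriminable (by norm_num) normSq_domino

/-! ### Cuts of product states -/

theorem cut_smul {n : ℕ} {d : Fin n → ℕ} (S : Finset (Fin n)) (z : ℂ) (ψ : Space d) :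
    cut S (z • ψ) = z • cut S ψ := rfl

theorem cut_sum {n : ℕ} {d : Fin n → ℕ} (S : Finset (Fin n)) {ι : Type*} [Fintype ι]
    (ψ : ι → Space d) : cut S (∑ i, ψ i) = ∑ i, cut S (ψ i) := by
  ext u v
  simp [cut, Matrix.sum_apply]

/-- The product vector of the parties that satisfy `p`. -/
def part {n : ℕ} {d : Fin n → ℕ} (p : Fin n → Prop) [DecidablePred p]
    (φ : ∀ j, EuclideanSpace ℂ (Fin (d j))) : (∀ j : {j // p j}, Fin (d j)) → ℂ :=
  fun u => ∏ j : {j // p j}, φ j (u j)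

section

variable {n : ℕ} {d : Fin n → ℕ}

section

variable (φ φ' : ∀ j, EuclideanSpace ℂ (Fin (d j)))

theorem cut_tensor (S : Finset (Fin n)) :
    cut S (tensor φ) = vecMulVec (part (· ∈ S) φ) (part (· ∉ S) φ) := by
  ext u v
  simp only [cut, tensor, vecMulVec_apply, part]
  rw [← Fintype.prod_subtype_mul_prod_subtype (· ∈ S)]
  congr 1 <;> refine Finset.prod_congr rfl fun j _ => ?_ <;>
    simp [Equiv.piEquivPiSubtypeProd, j.2]

theorem inner_tensor : inner ℂ (tensor φ) (tensor φ') = ∏ j, inner ℂ (φ j) (φ' j) := by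
  simp only [PiLp.inner_apply, Finset.prod_univ_sum, Fintype.piFinset_univ]
  simp [tensor, ← Finset.prod_mul_distrib]

theorem star_part_dotProduct_part (p : Fin n → Prop) [DecidablePred p] :
    star (part p φ) ⬝ᵥ part p φ' = ∏ j : {j // p j}, inner ℂ (φ j) (φ' j) := by
  simp only [PiLp.inner_apply, Finset.prod_univ_sum, Fintype.piFinset_univ]
  simp [dotProduct, part, ← Finset.prod_mul_distrib, mul_comm]

end

variable {φ : ∀ j, EuclideanSpace ℂ (Fin (d j))} {p : Fin n → Prop} [DecidablePred p]
  {j j' : Fin n} {κ κ' : Type}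

theorem part_update_of_not (hj : ¬ p j) (a : EuclideanSpace ℂ (Fin (d j))) :
    part p (Function.update φ j a) = part p φ := by
  ext u
  refine Finset.prod_congr rfl fun i _ => ?_
  rw [Function.update_of_ne (ne_of_mem_of_not_mem (s := {i | p i}) i.2 hj)]

theorem star_part_update_dotProduct (hj : p j) (hφ : ∀ i, ‖φ i‖ = 1)
    (a b : EuclideanSpace ℂ (Fin (d j))) :
    star (part p (Function.update φ j a)) ⬝ᵥ part p (Function.update φ j b) = inner ℂ a b := by
  rw [star_part_dotProduct_part, Fintype.prod_eq_single ⟨j, hj⟩]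
  · rw [Function.update_self, Function.update_self]
  · intro i hi
    have hne : (i : Fin n) ≠ j := fun h => hi (Subtype.ext h)
    rw [Function.update_of_ne hne, Function.update_of_ne hne, inner_self_eq_norm_sq_to_K, hφ,
      RCLike.ofReal_one, one_pow]

theorem cut_tensor_update {S : Finset (Fin n)} (hj : j ∈ S) (hj' : j' ∉ S)
    (a : EuclideanSpace ℂ (Fin (d j))) (b : EuclideanSpace ℂ (Fin (d j'))) :
    cut S (tensor (Function.update (Function.update φ j a) j' b)) =
      vecMulVec (part (· ∈ S) (Function.update φ j a))
        (part (· ∉ S) (Function.update φ j' b)) := by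
  have hne : j ≠ j' := ne_of_mem_of_not_mem hj hj'
  rw [cut_tensor, part_update_of_not hj', Function.update_comm hne,
    part_update_of_not (p := (· ∉ S)) (not_not.2 hj)]

/-- The matrix whose columns are the product vectors of the parties that satisfy `p`, with the
vector of the party `j` running through the frame `e`. -/
def partFrame (p : Fin n → Prop) [DecidablePred p] (φ : ∀ j, EuclideanSpace ℂ (Fin (d j)))
    (j : Fin n) (e : κ → EuclideanSpace ℂ (Fin (d j))) :
    Matrix (∀ j : {j // p j}, Fin (d j)) κ ℂ :=
  .of fun u k => part p (Function.update φ j (e k)) u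

theorem conjTranspose_mul_self_partFrame [DecidableEq κ] (hj : p j) (hφ : ∀ i, ‖φ i‖ = 1)
    {e : κ → EuclideanSpace ℂ (Fin (d j))} (he : Orthonormal ℂ e) :
    (partFrame p φ j e)ᴴ * partFrame p φ j e = 1 := by
  ext k l
  rw [one_apply, ← orthonormal_iff_ite.1 he k l, ← star_part_update_dotProduct hj hφ]
  rfl

variable [Fintype κ] [Fintype κ']

/-- The state in which the parties `j` and `j'` share the bipartite state `Ψ`, in the coordinates
of the frames `e` and `g`, and each other party holds its vector of `φ`. -/
def pairState (φ : ∀ j, EuclideanSpace ℂ (Fin (d j))) (j j' : Fin n)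
    (e : κ → EuclideanSpace ℂ (Fin (d j))) (g : κ' → EuclideanSpace ℂ (Fin (d j')))
    (Ψ : Matrix κ κ' ℂ) : Space d :=
  ∑ k, ∑ l, Ψ k l • tensor (Function.update (Function.update φ j (e k)) j' (g l))

variable {e : κ → EuclideanSpace ℂ (Fin (d j))} {g : κ' → EuclideanSpace ℂ (Fin (d j'))}

theorem pairState_comm (hne : j ≠ j') (Ψ : Matrix κ κ' ℂ) :
    pairState φ j' j g e Ψᵀ = pairState φ j j' e g Ψ := by
  rw [pairState, pairState, Finset.sum_comm]
  simp only [transpose_apply, Function.update_comm hne]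

theorem cut_pairState {S : Finset (Fin n)} (hj : j ∈ S) (hj' : j' ∉ S) (Ψ : Matrix κ κ' ℂ) :
    cut S (pairState φ j j' e g Ψ) =
      partFrame (· ∈ S) φ j e * Ψ * (partFrame (· ∉ S) φ j' g)ᵀ := by
  ext u v
  simp only [pairState, cut_sum, cut_smul, cut_tensor_update hj hj', Matrix.sum_apply,
    Matrix.smul_apply, vecMulVec_apply, smul_eq_mul, mul_apply, transpose_apply, partFrame,
    of_apply, Finset.sum_mul]
  rw [Finset.sum_comm]
  exact Finset.sum_congr rfl fun l _ => Finset.sum_congr rfl fun k _ => by ring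

theorem not_perfectlyDiscriminable_cut_of_mem [DecidableEq κ] [DecidableEq κ'] {ι : Type*}
    {Ψ : ι → Matrix κ κ' ℂ} (hΨ : ¬ PerfectlyDiscriminable Ψ) (inj : Function.Injective Ψ)
    (hφ : ∀ i, ‖φ i‖ = 1) (he : Orthonormal ℂ e) (hg : Orthonormal ℂ g) {G : Set (Space d)}
    (mem : ∀ i, pairState φ j j' e g (Ψ i) ∈ G) {S : Finset (Fin n)} (hj : j ∈ S) (hj' : j' ∉ S) :
    ¬ PerfectlyDiscriminable (fun ψ : G => cut S (ψ : Space d)) := by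
  refine fun h => hΨ <| h.of_isometric_copy ?_
    (conjTranspose_mul_self_partFrame (p := (· ∉ S)) hj' hφ hg) inj
    fun i => ⟨⟨_, mem i⟩, cut_pairState hj hj' (Ψ i)⟩
  -- `convert` identifies the two `Fintype` instances on `{j // j ∈ S}`.
  convert conjTranspose_mul_self_partFrame (p := (· ∈ S)) hj hφ he

theorem not_perfectlyDiscriminable_cut [DecidableEq κ] [DecidableEq κ'] {ι : Type*}
    {Ψ : ι → Matrix κ κ' ℂ} (hΨ : ¬ PerfectlyDiscriminable Ψ) (inj : Function.Injective Ψ)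
    (hφ : ∀ i, ‖φ i‖ = 1) (he : Orthonormal ℂ e) (hg : Orthonormal ℂ g) {G : Set (Space d)}
    (mem : ∀ i, pairState φ j j' e g (Ψ i) ∈ G) {S : Finset (Fin n)}
    (separates : ¬ (j ∈ S ↔ j' ∈ S)) :
    ¬ PerfectlyDiscriminable (fun ψ : G => cut S (ψ : Space d)) := by
  by_cases hj : j ∈ S
  · exact not_perfectlyDiscriminable_cut_of_mem hΨ inj hφ he hg mem hj
      fun hj' => separates (iff_of_true hj hj')
  · have hj' : j' ∈ S := by_contra fun hj' => separates (iff_of_false hj hj')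
    have hne : j ≠ j' := (ne_of_mem_of_not_mem hj' hj).symm
    refine not_perfectlyDiscriminable_cut_of_mem (Ψ := fun i => (Ψ i)ᵀ)
      (fun h => hΨ h.transpose) (transpose_injective.comp inj) hφ hg he (fun i => ?_) hj' hj
    rw [pairState_comm hne]
    exact mem i

end

/-! ### Copies of the domino states in `𝔾₃` -/

/-- The family of the three local vectors `a`, `b`, `c`. -/
def triple (a : EuclideanSpace ℂ (Fin 4)) (b c : EuclideanSpace ℂ (Fin 3)) :
    ∀ j, EuclideanSpace ℂ (Fin (![4, 3, 3] j)) := fun j => match j with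
  | 0 => a
  | 1 => b
  | 2 => c

theorem norm_triple {a : EuclideanSpace ℂ (Fin 4)} {b c : EuclideanSpace ℂ (Fin 3)}
    (ha : ‖a‖ = 1) (hb : ‖b‖ = 1) (hc : ‖c‖ = 1) (j : Fin 3) : ‖triple a b c j‖ = 1 := by
  fin_cases j
  exacts [ha, hb, hc]

theorem tri_apply (a : EuclideanSpace ℂ (Fin 4)) (b c : EuclideanSpace ℂ (Fin 3))
    (x : ∀ j, Fin (![4, 3, 3] j)) : tri a b c x = a (x 0) * b (x 1) * c (x 2) :=
  Fin.prod_univ_three fun j => triple a b c j (x j)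

theorem pm_apply {m : ℕ} (s : ℂ) (u v : EuclideanSpace ℂ (Fin m)) (k : Fin m) :
    pm s u v k = ((1 / √2 : ℝ) : ℂ) * (u k + s * v k) := rfl

theorem tri_pm_left (s : ℂ) (a a' : EuclideanSpace ℂ (Fin 4)) (b c : EuclideanSpace ℂ (Fin 3)) :
    tri (pm s a a') b c = ((1 / √2 : ℝ) : ℂ) • (tri a b c + s • tri a' b c) := by
  ext x
  simp only [tri_apply, PiLp.smul_apply, PiLp.add_apply, smul_eq_mul]
  linear_combination b (x 1) * c (x 2) * pm_apply s a a' (x 0)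

theorem tri_pm_middle (s : ℂ) (a : EuclideanSpace ℂ (Fin 4)) (b b' c : EuclideanSpace ℂ (Fin 3)) :
    tri a (pm s b b') c = ((1 / √2 : ℝ) : ℂ) • (tri a b c + s • tri a b' c) := by
  ext x
  simp only [tri_apply, PiLp.smul_apply, PiLp.add_apply, smul_eq_mul]
  linear_combination a (x 0) * c (x 2) * pm_apply s b b' (x 1)

theorem tri_pm_right (s : ℂ) (a : EuclideanSpace ℂ (Fin 4)) (b c c' : EuclideanSpace ℂ (Fin 3)) :
    tri a b (pm s c c') = ((1 / √2 : ℝ) : ℂ) • (tri a b c + s • tri a b c') := by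
  ext x
  simp only [tri_apply, PiLp.smul_apply, PiLp.add_apply, smul_eq_mul]
  linear_combination a (x 0) * b (x 1) * pm_apply s c c' (x 2)

theorem tensor_update_triple_zero_one (a a' : EuclideanSpace ℂ (Fin 4))
    (b b' c : EuclideanSpace ℂ (Fin 3)) :
    tensor (Function.update (Function.update (triple a b c) 0 a') 1 b') = tri a' b' c := by
  refine congrArg tensor (funext fun j => ?_)
  fin_cases j <;> rfl

theorem tensor_update_triple_zero_two (a a' : EuclideanSpace ℂ (Fin 4))
    (b c c' : EuclideanSpace ℂ (Fin 3)) :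
    tensor (Function.update (Function.update (triple a b c) 0 a') 2 c') = tri a' b c' := by
  refine congrArg tensor (funext fun j => ?_)
  fin_cases j <;> rfl

theorem inner_tri (a a' : EuclideanSpace ℂ (Fin 4)) (b b' c c' : EuclideanSpace ℂ (Fin 3)) :
    inner ℂ (tri a b c) (tri a' b' c') = inner ℂ a a' * inner ℂ b b' * inner ℂ c c' := by
  rw [tri, tri, inner_tensor, Fin.prod_univ_three]
  rfl

theorem inner_pm_left {m : ℕ} (s : ℂ) (u v w : EuclideanSpace ℂ (Fin m)) :
    inner ℂ (pm s u v) w =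
      ((1 / √2 : ℝ) : ℂ) * (inner ℂ u w + starRingEnd ℂ s * inner ℂ v w) := by
  rw [pm, inner_smul_left, inner_add_left, inner_smul_left, Complex.conj_ofReal]

theorem inner_pm_right {m : ℕ} (s : ℂ) (u v w : EuclideanSpace ℂ (Fin m)) :
    inner ℂ w (pm s u v) = ((1 / √2 : ℝ) : ℂ) * (inner ℂ w u + s * inner ℂ w v) := by
  rw [pm, inner_smul_right, inner_add_right, inner_smul_right]

theorem inner_pm_pm {m : ℕ} {κ : Type*} {e : κ → EuclideanSpace ℂ (Fin m)}
    (he : Orthonormal ℂ e) {k l : κ} (hkl : k ≠ l) (s t : ℤˣ) :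
    inner ℂ (pm ((s : ℤ) : ℂ) (e k) (e l)) (pm ((t : ℤ) : ℂ) (e k) (e l)) =
      if s = t then (1 : ℂ) else 0 := by
  classical
  have normalization := one_div_sqrt_two_mul_self
  simp only [inner_pm_left, inner_pm_right, orthonormal_iff_ite.1 he, if_pos, if_neg hkl,
    if_neg hkl.symm, map_intCast]
  generalize ((1 / √2 : ℝ) : ℂ) = c at normalization ⊢
  rcases Int.units_eq_one_or s with rfl | rfl <;> rcases Int.units_eq_one_or t with rfl | rfl <;>
    norm_num [mul_add, normalization]

section

variable (e : Fin 4 → EuclideanSpace ℂ (Fin 4)) (f g : Fin 3 → EuclideanSpace ℂ (Fin 3))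

/-- The fourteen states of `𝔾₃` as an indexed family. -/
def G3Family (i : Fin 7 × ℤˣ) : Space ![4, 3, 3] :=
  ![tri (pm ((i.2 : ℤ) : ℂ) (e 0) (e 1)) (f 2) (g 2),
    tri (e 2) (pm ((i.2 : ℤ) : ℂ) (f 1) (f 2)) (g 2),
    tri (pm ((i.2 : ℤ) : ℂ) (e 1) (e 2)) (f 0) (g 2),
    tri (e 0) (pm ((i.2 : ℤ) : ℂ) (f 0) (f 1)) (g 2),
    tri (e 3) (f 2) (pm ((i.2 : ℤ) : ℂ) (g 1) (g 2)),
    tri (pm ((i.2 : ℤ) : ℂ) (e 1) (e 3)) (f 2) (g 0),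
    tri (e 0) (f 2) (pm ((i.2 : ℤ) : ℂ) (g 0) (g 1))] i.1

theorem range_G3Family : Set.range (G3Family e f g) =
    G3 (e 0) (e 1) (e 2) (e 3) (f 0) (f 1) (f 2) (g 0) (g 1) (g 2) := by
  refine subset_antisymm (Set.range_subset_iff.2 fun ⟨k, s⟩ => ?_)
    (Set.iUnion₂_subset fun z hz ψ hψ => ?_)
  · have sign_mem : ((s : ℤ) : ℂ) ∈ ({1, -1} : Set ℂ) := by
      rcases Int.units_eq_one_or s with rfl | rfl <;> simp
    refine Set.mem_biUnion sign_mem ?_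
    fin_cases k <;> simp [G3Family]
  · obtain ⟨s, rfl⟩ : ∃ s : ℤˣ, ((s : ℤ) : ℂ) = z := by
      rcases hz with rfl | rfl
      exacts [⟨1, by simp⟩, ⟨-1, by simp⟩]
    rcases hψ with rfl | rfl | rfl | rfl | rfl | rfl | rfl
    exacts [⟨(0, s), rfl⟩, ⟨(1, s), rfl⟩, ⟨(2, s), rfl⟩, ⟨(3, s), rfl⟩, ⟨(4, s), rfl⟩,
      ⟨(5, s), rfl⟩, ⟨(6, s), rfl⟩]

theorem pairState_zero_one_domino (a : EuclideanSpace ℂ (Fin 4)) (b : EuclideanSpace ℂ (Fin 3))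
    (i : Fin 4 × ℤˣ) :
    pairState (triple a b (g 2)) 0 1 (e ∘ ![0, 1, 2]) f (domino i) =
      G3Family e f g (![0, 1, 2, 3] i.1, i.2) := by
  obtain ⟨i, s⟩ := i
  fin_cases i <;>
    simp [pairState, domino, tile, next, G3Family, tensor_update_triple_zero_one, tri_pm_left,
      tri_pm_middle, Fin.sum_univ_three, mul_smul]

theorem pairState_zero_two_domino (a : EuclideanSpace ℂ (Fin 4)) (c : EuclideanSpace ℂ (Fin 3))
    (i : Fin 4 × ℤˣ) :
    pairState (triple a (f 2) c) 0 2 (e ∘ ![0, 1, 3]) g (domino i) =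
      G3Family e f g (![0, 4, 5, 6] i.1, i.2) := by
  obtain ⟨i, s⟩ := i
  fin_cases i <;>
    simp [pairState, domino, tile, next, G3Family, tensor_update_triple_zero_two, tri_pm_left,
      tri_pm_right, Fin.sum_univ_three, mul_smul]

end

section

variable {e : Fin 4 → EuclideanSpace ℂ (Fin 4)} {f g : Fin 3 → EuclideanSpace ℂ (Fin 3)}

theorem orthonormal_G3Family (he : Orthonormal ℂ e) (hf : Orthonormal ℂ f)
    (hg : Orthonormal ℂ g) : Orthonormal ℂ (G3Family e f g) := by
  rw [orthonormal_iff_ite]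
  rintro ⟨k, s⟩ ⟨l, t⟩
  fin_cases k <;> fin_cases l <;>
    simp [G3Family, inner_tri, inner_pm_pm he, inner_pm_pm hf, inner_pm_pm hg, inner_pm_left,
      inner_pm_right, orthonormal_iff_ite.1 he, orthonormal_iff_ite.1 hf,
      orthonormal_iff_ite.1 hg, -inner_self_eq_norm_sq_to_K]

theorem exists_G3Family_eq_tensor (i : Fin 7 × ℤˣ) : ∃ φ, G3Family e f g i = tensor φ := by
  obtain ⟨i, s⟩ := i
  fin_cases i <;> exact ⟨_, rfl⟩

theorem separates_zero_one_or_zero_two {S : Finset (Fin 3)} (hS : S.Nonempty)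
    (hS' : Sᶜ.Nonempty) : ¬ (0 ∈ S ↔ 1 ∈ S) ∨ ¬ (0 ∈ S ↔ 2 ∈ S) := by
  decide +revert

theorem not_perfectlyDiscriminable_cut_G3Family (he : Orthonormal ℂ e) (hf : Orthonormal ℂ f)
    (hg : Orthonormal ℂ g) {S : Finset (Fin 3)} (hS : S.Nonempty) (hS' : Sᶜ.Nonempty) :
    ¬ PerfectlyDiscriminable fun ψ : Set.range (G3Family e f g) =>
      cut S (ψ : Space ![4, 3, 3]) := by
  have norm_eq_one (j : Fin 3) : ‖triple (e 0) (f 2) (g 2) j‖ = 1 :=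
    norm_triple (he.1 0) (hf.1 2) (hg.1 2) j
  rcases separates_zero_one_or_zero_two hS hS' with separates | separates
  · refine not_perfectlyDiscriminable_cut (φ := triple (e 0) (f 2) (g 2)) (j := 0) (j' := 1)
      (e := e ∘ ![0, 1, 2]) (g := f) not_perfectlyDiscriminable_domino domino_injective
      norm_eq_one (he.comp ![0, 1, 2] (by decide)) hf (fun i => ?_) separates
    rw [pairState_zero_one_domino]
    exact Set.mem_range_self _
  · refine not_perfectlyDiscriminable_cut (φ := triple (e 0) (f 2) (g 2)) (j := 0) (j' := 2)
      (e := e ∘ ![0, 1, 3]) (g := g) not_perfectlyDiscriminable_domino domino_injective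
      norm_eq_one (he.comp ![0, 1, 3] (by decide)) hg (fun i => ?_) separates
    rw [pairState_zero_two_domino]
    exact Set.mem_range_self _

end

end GNPS

end

theorem proposition1
    (pA qA oneA twoA : EuclideanSpace ℂ (Fin 4))
    (pB qB oneB : EuclideanSpace ℂ (Fin 3))
    (pC qC twoC : EuclideanSpace ℂ (Fin 3))
    (hA : Orthonormal ℂ ![pA, qA, oneA, twoA])
    (hB : Orthonormal ℂ ![pB, qB, oneB])
    (hC : Orthonormal ℂ ![pC, qC, twoC]) :
    GNPS.IsGNPS (GNPS.G3 pA qA oneA twoA pB qB oneB pC qC twoC) := by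
  have range_eq : Set.range
      (GNPS.G3Family ![pA, qA, oneA, twoA] ![pB, qB, oneB] ![pC, qC, twoC]) =
      GNPS.G3 pA qA oneA twoA pB qB oneB pC qC twoC := GNPS.range_G3Family _ _ _
  rw [← range_eq]
  exact
    { orthonormal := (GNPS.orthonormal_G3Family hA hB hC).toSubtypeRange
      product := Set.forall_mem_range.2 GNPS.exists_G3Family_eq_tensor
      nonlocal := fun _ hS hS' => GNPS.not_perfectlyDiscriminable_cut_G3Family hA hB hC hS hS' }
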